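/- Let $\Sigma$ be a finite set, $\Delta(\Sigma)$ the simplex of probability vectors on $\Sigma$, and $p\in\Delta(\Sigma)$. Let $G$ be a random vector with values in a set $\mathbb{G}\subseteq\mathbb{R}^{\Sigma}$ whose coordinates $(G_u)_{u\in\Sigma}$ are i.i.d. with an atomless law $\mathcal{L}$ on $\mathbb{R}$ (that is, with continuous distribution function) that has a finite first moment. Let $\varepsilon\ge 0$ and let $D:\Delta(\Sigma)\times\Delta(\Sigma)\to\mathbb{R}$ be any function. Consider the problem $$\text{maximize}\quad \mathbb{E}[G\cdot q(G)]\quad\text{over measurable } q:\mathbb{G}\to\Delta(\Sigma),\quad\text{subject to}\quad D(\mathbb{E}[q(G)],p)\le\varepsilon .$$ (i) If the problem has an optimal solution, then it has a deterministic optimal solution, i.e. an optimal solution $q^*$ such that for every $g\in\mathbb{G}$ the distribution $q^*(g)$ is a Dirac mass (its support has size $1$). (ii) If the problem is feasible and the set $\{r\in\Delta(\Sigma): D(r,p)\le\varepsilon\}$ is closed (for instance, if $D(\cdot,p)$ is lower semicontinuous), then it has a deterministic optimal solution. -/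

import Mathlib

open MeasureTheory ProbabilityTheory

namespace Watermark

/-- A sampling mechanism `q : 𝔾 → Δ(S)`: a measurable map that sends each score vector `g ∈ 𝔾` to a
probability distribution on the finite vocabulary `S`. -/
structure Mechanism {S : Type*} [Fintype S] (𝔾 : Set (S → ℝ)) where
  toFun : 𝔾 → stdSimplex ℝ S
  measurable_toFun : Measurable toFun

namespace Mechanism

variable {S : Type*} [Fintype S] {𝔾 : Set (S → ℝ)}

/-- `q(g)_u`, the probability of the token `u` when the scores are `g`. -/
def prob (q : Mechanism 𝔾) (g : 𝔾) (u : S) : ℝ := (q.toFun g : S → ℝ) u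

theorem measurable_prob (q : Mechanism 𝔾) (u : S) : Measurable fun g => q.prob g u :=
  (measurable_pi_apply u).comp (measurable_subtype_coe.comp q.measurable_toFun)

theorem prob_nonneg (q : Mechanism 𝔾) (g : 𝔾) (u : S) : 0 ≤ q.prob g u :=
  (q.toFun g).2.1 u

theorem sum_prob (q : Mechanism 𝔾) (g : 𝔾) : ∑ u, q.prob g u = 1 :=
  (q.toFun g).2.2

theorem prob_le_one (q : Mechanism 𝔾) (g : 𝔾) (u : S) : q.prob g u ≤ 1 := by
  rw [← q.sum_prob g]
  exact Finset.single_le_sum (fun v _ => q.prob_nonneg g v) (Finset.mem_univ u)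

theorem integrable_prob {Ω : Type*} [MeasurableSpace Ω] (P : Measure Ω) [IsProbabilityMeasure P]
    {G : Ω → 𝔾} (hG : Measurable G) (q : Mechanism 𝔾) (u : S) :
    Integrable (fun ω => q.prob (G ω) u) P := by
  refine Integrable.of_bound (C := 1)
    ((q.measurable_prob u).comp hG).aestronglyMeasurable (Filter.Eventually.of_forall fun ω => ?_)
  rw [Real.norm_eq_abs, abs_of_nonneg (q.prob_nonneg _ _)]
  exact q.prob_le_one _ _

/-- The average output distribution `𝔼[q(G)] ∈ Δ(S)`, taken coordinate by coordinate. -/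
noncomputable def mean {Ω : Type*} [MeasurableSpace Ω] (P : Measure Ω) [IsProbabilityMeasure P]
    {G : Ω → 𝔾} (hG : Measurable G) (q : Mechanism 𝔾) : stdSimplex ℝ S :=
  ⟨fun u => ∫ ω, q.prob (G ω) u ∂P, fun u => integral_nonneg fun ω => q.prob_nonneg (G ω) u, by
    rw [← integral_finsetSum _ fun u _ => q.integrable_prob P hG u]
    simp [q.sum_prob]⟩

/-- The objective `𝔼[G · q(G)]`. -/
noncomputable def objective {Ω : Type*} [MeasurableSpace Ω] (P : Measure Ω)
    (G : Ω → 𝔾) (q : Mechanism 𝔾) : ℝ :=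
  ∫ ω, ∑ u, (G ω : S → ℝ) u * q.prob (G ω) u ∂P

/-- The soft constraint `D(𝔼[q(G)], p) ≤ ε`. -/
def IsFeasible {Ω : Type*} [MeasurableSpace Ω] (P : Measure Ω) [IsProbabilityMeasure P]
    {G : Ω → 𝔾} (hG : Measurable G) (D : stdSimplex ℝ S → stdSimplex ℝ S → ℝ)
    (p : stdSimplex ℝ S) (ε : ℝ) (q : Mechanism 𝔾) : Prop :=
  D (q.mean P hG) p ≤ ε

/-- `q` is feasible and maximizes the objective among all feasible mechanisms. -/
def IsOptimal {Ω : Type*} [MeasurableSpace Ω] (P : Measure Ω) [IsProbabilityMeasure P]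
    {G : Ω → 𝔾} (hG : Measurable G) (D : stdSimplex ℝ S → stdSimplex ℝ S → ℝ)
    (p : stdSimplex ℝ S) (ε : ℝ) (q : Mechanism 𝔾) : Prop :=
  q.IsFeasible P hG D p ε ∧
    ∀ q' : Mechanism 𝔾, q'.IsFeasible P hG D p ε → q'.objective P G ≤ q.objective P G

/-- Every `q(g)` is a Dirac mass, i.e. its support has exactly one element. -/
def IsDeterministic (q : Mechanism 𝔾) : Prop :=
  ∀ g : 𝔾, ∃ u : S, q.prob g u = 1 ∧ ∀ v : S, v ≠ u → q.prob g v = 0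

end Mechanism

end Watermark

/-! The problem splits according to the mean `r` of the mechanism. Over mechanisms with mean `r` it
is a semi-discrete optimal transport problem, with dual `inf_l 𝔼[max_u (G_u - l_u)] + ∑ l_u r_u`.
Weak duality bounds every objective by every dual value (`objective_le_dualObjective`).

Conversely, let `T` be the support of `r` and `l` a minimizer of the dual restricted to `T`.
Selecting a maximizer of `G_u - l_u` over `T` gives a Dirac mass at each `g`. Minimality says that
`u` is the strict winner with probability at most `r_u`. Ties are null because the scores are
independent and atomless, so the mean of the selection is at most `r` in each coordinate, hence
equal to `r` as both sum to one. Its objective is the dual value, so there is no gap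
(`exists_isDeterministic_mean_eq`).

Replacing an optimal mechanism by the selection with the same mean gives (i). For (ii), the value as
a function of `r` is an infimum of affine functions, hence upper semicontinuous, and it attains its
maximum on a closed subset of the compact simplex. -/

namespace Watermark

/-! ### The dual objective and its minimizers -/

section Potential

variable {S Ω : Type*} [MeasurableSpace Ω] {P : Measure Ω}

/-- The expected best shifted score `𝔼[max_{u ∈ T} (X_u - l_u)]`. -/
noncomputable def expectedMax (P : Measure Ω) (X : Ω → S → ℝ) (T : Finset S) (hT : T.Nonempty)
    (l : S → ℝ) : ℝ :=
  ∫ ω, T.sup' hT (fun u => X ω u - l u) ∂P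

theorem integrable_sup' [IsFiniteMeasure P] {X : Ω → S → ℝ}
    (hX : ∀ u, Integrable (fun ω => X ω u) P) (T : Finset S) (hT : T.Nonempty) (l : S → ℝ) :
    Integrable (fun ω => T.sup' hT (fun u => X ω u - l u)) P := by
  have h : Integrable (T.sup' hT (fun u ω => X ω u - l u)) P :=
    Finset.sup'_induction (p := fun f : Ω → ℝ => Integrable f P) hT _
      (fun _ h₁ _ h₂ => h₁.sup h₂) fun u _ => (hX u).sub (integrable_const _)
  convert h using 1
  ext ω
  rw [Finset.sup'_apply]

theorem sup'_sub_le_add_norm [Fintype S] (x : S → ℝ) (T : Finset S) (hT : T.Nonempty)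
    (l l' : S → ℝ) :
    T.sup' hT (fun u => x u - l u) ≤ T.sup' hT (fun u => x u - l' u) + ‖l - l'‖ := by
  refine Finset.sup'_le hT _ fun u hu => ?_
  have h₁ := Finset.le_sup' (fun u => x u - l' u) hu
  have h₂ := norm_le_pi_norm (l - l') u
  rw [Pi.sub_apply, Real.norm_eq_abs] at h₂
  have h₃ := neg_abs_le (l u - l' u)
  linarith

theorem continuous_expectedMax [Fintype S] [IsProbabilityMeasure P] {X : Ω → S → ℝ}
    (hX : ∀ u, Integrable (fun ω => X ω u) P) (T : Finset S) (hT : T.Nonempty) :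
    Continuous (expectedMax P X T hT) := by
  refine (LipschitzWith.of_le_add fun l l' => ?_).continuous
  have h : expectedMax P X T hT l ≤ ∫ ω, (T.sup' hT (fun u => X ω u - l' u) + ‖l - l'‖) ∂P :=
    integral_mono (integrable_sup' hX T hT l)
      ((integrable_sup' hX T hT l').add (integrable_const _))
      fun ω => sup'_sub_le_add_norm (X ω) T hT l l'
  rw [integral_add (integrable_sup' hX T hT l') (integrable_const _)] at h
  simpa [dist_eq_norm, expectedMax] using h

theorem integral_sub_le_expectedMax [IsProbabilityMeasure P] {X : Ω → S → ℝ}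
    (hX : ∀ u, Integrable (fun ω => X ω u) P) (T : Finset S) (hT : T.Nonempty) (l : S → ℝ)
    {u : S} (hu : u ∈ T) : (∫ ω, X ω u ∂P) - l u ≤ expectedMax P X T hT l := by
  have h : ∫ ω, (X ω u - l u) ∂P ≤ expectedMax P X T hT l :=
    integral_mono ((hX u).sub (integrable_const _)) (integrable_sup' hX T hT l)
      fun ω => Finset.le_sup' (fun u => X ω u - l u) hu
  rw [integral_sub (hX u) (integrable_const _)] at h
  simpa using h

/-- The dual objective of the transport problem with target marginal `r`. -/
noncomputable def dualObjective [Fintype S] (P : Measure Ω) (X : Ω → S → ℝ) (T : Finset S)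
    (hT : T.Nonempty) (r l : S → ℝ) : ℝ :=
  expectedMax P X T hT l + ∑ u, l u * r u

theorem continuous_dualObjective [Fintype S] [IsProbabilityMeasure P] {X : Ω → S → ℝ}
    (hX : ∀ u, Integrable (fun ω => X ω u) P) (T : Finset S) (hT : T.Nonempty) (r : S → ℝ) :
    Continuous (dualObjective P X T hT r) :=
  (continuous_expectedMax hX T hT).add
    (continuous_finsetSum _ fun u _ => (continuous_apply u).mul continuous_const)

theorem sup'_sub_eq_of_shift (x : S → ℝ) (T : Finset S) (hT : T.Nonempty)
    {l l' : S → ℝ} {m : ℝ} (h : ∀ u ∈ T, l' u = l u - m) :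
    T.sup' hT (fun u => x u - l' u) = T.sup' hT (fun u => x u - l u) + m := by
  apply le_antisymm
  · refine Finset.sup'_le hT _ fun u hu => ?_
    have := Finset.le_sup' (fun u => x u - l u) hu
    rw [h u hu]; linarith
  · rw [← le_sub_iff_add_le]
    refine Finset.sup'_le hT _ fun u hu => ?_
    have := Finset.le_sup' (fun u => x u - l' u) hu
    simp only [h u hu] at this
    linarith

theorem dualObjective_eq_of_shift [Fintype S] [IsProbabilityMeasure P] {X : Ω → S → ℝ}
    (hX : ∀ u, Integrable (fun ω => X ω u) P) (T : Finset S) (hT : T.Nonempty) {r : S → ℝ}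
    (hr : ∑ u, r u = 1) (hrT : ∀ u, u ∉ T → r u = 0)
    {l l' : S → ℝ} {m : ℝ} (h : ∀ u ∈ T, l' u = l u - m) :
    dualObjective P X T hT r l' = dualObjective P X T hT r l := by
  have h₁ : expectedMax P X T hT l' = expectedMax P X T hT l + m := by
    unfold expectedMax
    simp_rw [sup'_sub_eq_of_shift _ T hT h]
    rw [integral_add (integrable_sup' hX T hT l) (integrable_const _)]
    simp
  have h₂ : ∑ u, l' u * r u = ∑ u, (l u * r u - m * r u) := by
    refine Finset.sum_congr rfl fun u _ => ?_
    by_cases hu : u ∈ T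
    · rw [h u hu]; ring
    · simp [hrT u hu]
  rw [Finset.sum_sub_distrib, ← Finset.mul_sum, hr] at h₂
  unfold dualObjective
  rw [h₁, h₂]; ring

/-- Coercivity modulo constants: after a shift making the minimum of `l` over `T` zero, the expected
maximum is at least `-C`, while a coordinate above `M` makes the linear term at least `J 0 + C`. So
no point outside the box beats `0`. -/
theorem exists_forall_dualObjective_le [Fintype S] [IsProbabilityMeasure P] {X : Ω → S → ℝ}
    (hX : ∀ u, Integrable (fun ω => X ω u) P) (T : Finset S) (hT : T.Nonempty) {r : S → ℝ}
    (hr : ∑ u, r u = 1) (hpos : ∀ u ∈ T, 0 < r u) (hrT : ∀ u, u ∉ T → r u = 0) :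
    ∃ l, ∀ l', dualObjective P X T hT r l ≤ dualObjective P X T hT r l' := by
  classical
  set J := dualObjective P X T hT r with hJ
  set C := ∑ u, |∫ ω, X ω u ∂P|
  set M := ∑ u ∈ T, |J 0 + C| / r u
  have hM : 0 ≤ M := Finset.sum_nonneg fun u hu => div_nonneg (abs_nonneg _) (hpos u hu).le
  have hMr : ∀ u ∈ T, J 0 + C ≤ M * r u := fun u hu => by
    rw [← div_le_iff₀ (hpos u hu)]
    exact (div_le_div_of_nonneg_right (le_abs_self _) (hpos u hu).le).trans
      (Finset.single_le_sum (f := fun u => |J 0 + C| / r u)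
        (fun u hu => div_nonneg (abs_nonneg _) (hpos u hu).le) hu)
  have h0 : (0 : S → ℝ) ∈ Set.Icc (0 : S → ℝ) (fun _ => M) := ⟨le_rfl, fun _ => hM⟩
  obtain ⟨l, -, hl⟩ := (isCompact_Icc (a := (0 : S → ℝ)) (b := fun _ => M)).exists_isMinOn
    ⟨0, h0⟩ (continuous_dualObjective hX T hT r).continuousOn
  refine ⟨l, fun l' => ?_⟩
  obtain ⟨v, hv, hvmin⟩ := T.exists_min_image l' hT
  -- The values off `T` do not affect `J`; zero keeps them in the box.
  set l'' : S → ℝ := fun u => if u ∈ T then l' u - l' v else 0 with hl''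
  have hnn : ∀ u, 0 ≤ l'' u := fun u => by
    by_cases hu : u ∈ T
    · simp only [hl'', if_pos hu]; linarith [hvmin u hu]
    · simp [hl'', hu]
  have hshift : J l'' = J l' :=
    dualObjective_eq_of_shift hX T hT hr hrT (m := l' v) fun u hu => by simp [hl'', hu]
  rw [← hshift]
  by_cases hbox : ∀ u, l'' u ≤ M
  · exact hl ⟨hnn, hbox⟩
  · push Not at hbox
    obtain ⟨u, hu⟩ := hbox
    have huT : u ∈ T := by
      by_contra h
      simp only [hl'', if_neg h] at hu
      linarith
    refine (hl h0).trans ?_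
    have h₁ := integral_sub_le_expectedMax hX T hT l'' hv
    have h₂ : l'' v = 0 := by simp [hl'']
    have hrnn : ∀ u, 0 ≤ r u := fun u => by
      by_cases h : u ∈ T
      · exact (hpos u h).le
      · exact (hrT u h).ge
    have h₃ : l'' u * r u ≤ ∑ u, l'' u * r u :=
      Finset.single_le_sum (f := fun u => l'' u * r u)
        (fun u _ => mul_nonneg (hnn u) (hrnn u)) (Finset.mem_univ u)
    have h₄ : |∫ ω, X ω v ∂P| ≤ C :=
      Finset.single_le_sum (f := fun u => |∫ ω, X ω u ∂P|)
        (fun u _ => abs_nonneg _) (Finset.mem_univ v)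
    have h₅ := neg_abs_le (∫ ω, X ω v ∂P)
    have h₆ := mul_le_mul_of_nonneg_right hu.le (hrnn u)
    have h₇ := hMr u huT
    change J 0 ≤ expectedMax P X T hT l'' + ∑ u, l'' u * r u
    linarith

/-! ### First-order condition at a minimizer -/

/-- Raising `l u` by `t` lowers the maximum by `t` wherever `u` wins by at least `t`, never
increases it elsewhere, and adds `t * r u` to the linear term. Minimality forbids a net decrease. -/
theorem measureReal_margin_le_of_minimizer [Fintype S] [IsProbabilityMeasure P] {X : Ω → S → ℝ}
    (hXm : ∀ u, Measurable fun ω => X ω u)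
    (hX : ∀ u, Integrable (fun ω => X ω u) P) (T : Finset S) (hT : T.Nonempty) {r l : S → ℝ}
    (hl : ∀ l', dualObjective P X T hT r l ≤ dualObjective P X T hT r l') {u : S} (hu : u ∈ T)
    {t : ℝ} (ht : 0 < t) :
    P.real {ω | ∀ v ∈ T, v ≠ u → X ω v - l v ≤ X ω u - l u - t} ≤ r u := by
  classical
  set A : Set Ω := {ω | ∀ v ∈ T, v ≠ u → X ω v - l v ≤ X ω u - l u - t} with hA
  have hAm : MeasurableSet A := by
    have : A = ⋂ v ∈ T, ⋂ (_ : v ≠ u), {ω | X ω v - l v ≤ X ω u - l u - t} := by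
      ext; simp [hA]
    rw [this]
    exact Finset.measurableSet_biInter _ fun v _ => MeasurableSet.iInter fun _ =>
      measurableSet_le ((hXm v).sub_const _) (((hXm u).sub_const _).sub_const _)
  set l' : S → ℝ := l + Pi.single u t with hl'
  have hu' : l' u = l u + t := by simp [hl']
  have hv' : ∀ v, v ≠ u → l' v = l v := fun v hv => by simp [hl', hv]
  have hge : ∀ v, l v ≤ l' v := fun v => by
    by_cases h : v = u
    · subst h; linarith
    · exact (hv' v h).ge
  have key : ∀ ω, A.indicator (fun _ => t) ω + T.sup' hT (fun v => X ω v - l' v)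
      ≤ T.sup' hT (fun v => X ω v - l v) := fun ω => by
    by_cases hω : ω ∈ A
    · rw [Set.indicator_of_mem hω, ← le_sub_iff_add_le']
      refine Finset.sup'_le hT _ fun v hv => ?_
      have h₁ := Finset.le_sup' (fun v => X ω v - l v) hu
      by_cases h : v = u
      · subst h; linarith
      · have := hω v hv h
        rw [hv' v h]; linarith
    · rw [Set.indicator_of_notMem hω, zero_add]
      exact Finset.sup'_mono_fun fun v _ => sub_le_sub_left (hge v) _
  have h₁ := integral_mono
    (((integrable_const t).indicator hAm).add (integrable_sup' hX T hT l'))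
    (integrable_sup' hX T hT l) key
  simp only [Pi.add_apply] at h₁
  rw [integral_add ((integrable_const t).indicator hAm) (integrable_sup' hX T hT l'),
    integral_indicator_const t hAm, smul_eq_mul] at h₁
  have h₂ := hl l'
  have h₃ : ∑ v, l' v * r v = ∑ v, l v * r v + t * r u := by
    simp [hl', add_mul, Finset.sum_add_distrib, Pi.single_apply]
  unfold dualObjective expectedMax at h₂
  rw [h₃] at h₂
  have h₄ : P.real A * t ≤ r u * t := by linarith
  exact le_of_mul_le_mul_right h₄ ht

theorem measureReal_strict_le_of_minimizer [Fintype S] [IsProbabilityMeasure P] {X : Ω → S → ℝ}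
    (hXm : ∀ u, Measurable fun ω => X ω u)
    (hX : ∀ u, Integrable (fun ω => X ω u) P) (T : Finset S) (hT : T.Nonempty) {r l : S → ℝ}
    (hl : ∀ l', dualObjective P X T hT r l ≤ dualObjective P X T hT r l') {u : S} (hu : u ∈ T) :
    P.real {ω | ∀ v ∈ T, v ≠ u → X ω v - l v < X ω u - l u} ≤ r u := by
  set A : ℕ → Set Ω := fun n =>
    {ω | ∀ v ∈ T, v ≠ u → X ω v - l v ≤ X ω u - l u - 1 / ((n : ℝ) + 1)} with hA
  have hmono : Monotone A := fun n m hnm ω hω v hv hvu => by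
    have := Nat.one_div_le_one_div (α := ℝ) hnm
    linarith [hω v hv hvu]
  have hUnion : {ω | ∀ v ∈ T, v ≠ u → X ω v - l v < X ω u - l u} = ⋃ n, A n := by
    ext ω
    simp only [Set.mem_ofPred_eq, Set.mem_iUnion]
    constructor
    · intro h
      have hev : ∀ᶠ n : ℕ in Filter.atTop, ∀ v ∈ T, v ≠ u →
          X ω v - l v ≤ X ω u - l u - 1 / ((n : ℝ) + 1) := by
        rw [Filter.eventually_all_finset]
        intro v hv
        by_cases hvu : v = u
        · simp [hvu]
        have := (tendsto_one_div_add_atTop_nhds_zero_nat (𝕜 := ℝ)).eventually_lt_const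
          (sub_pos.2 (h v hv hvu))
        filter_upwards [this] with n hn _
        linarith
      exact hev.exists
    · rintro ⟨n, hn⟩ v hv hvu
      have : 0 < 1 / ((n : ℝ) + 1) := Nat.one_div_pos_of_nat
      linarith [hn v hv hvu]
  rw [hUnion]
  have hlim := (ENNReal.tendsto_toReal (measure_ne_top P _)).comp
    (tendsto_measure_iUnion_atTop (μ := P) hmono)
  exact le_of_tendsto' hlim fun n =>
    measureReal_margin_le_of_minimizer hXm hX T hT hl hu Nat.one_div_pos_of_nat

/-! ### Measurable selection, null ties and vanishing coordinates -/

theorem exists_measurable_argmax {α : Type*} [MeasurableSpace α] {f : S → α → ℝ}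
    (hf : ∀ u, Measurable (f u)) {T : Finset S} (hT : T.Nonempty) :
    ∃ s : α → S, (∀ u, MeasurableSet (s ⁻¹' {u})) ∧
      ∀ a, s a ∈ T ∧ ∀ v ∈ T, f v a ≤ f (s a) a := by
  classical
  -- Measurability of the running maximum is carried through the induction: it makes the comparison
  -- with the new element a measurable event.
  suffices h : ∃ s : α → S, (∀ u, MeasurableSet (s ⁻¹' {u})) ∧ (Measurable fun a => f (s a) a) ∧
      ∀ a, s a ∈ T ∧ ∀ v ∈ T, f v a ≤ f (s a) a by
    obtain ⟨s, h₁, -, h₂⟩ := h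
    exact ⟨s, h₁, h₂⟩
  induction hT using Finset.Nonempty.cons_induction with
  | singleton b =>
    exact ⟨fun _ => b, fun u => MeasurableSet.const _, hf b, fun a => by simp⟩
  | cons b T hb hT ih =>
    obtain ⟨s, h₁, h₂, h₃⟩ := ih
    have hm : MeasurableSet {a | f (s a) a ≤ f b a} := measurableSet_le h₂ (hf b)
    refine ⟨fun a => if f (s a) a ≤ f b a then b else s a, fun u => ?_, ?_, fun a => ?_⟩
    · have : (fun a => if f (s a) a ≤ f b a then b else s a) ⁻¹' {u}
          = {a | f (s a) a ≤ f b a}.ite {_a | b = u} (s ⁻¹' {u}) := by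
        ext a
        by_cases h : f (s a) a ≤ f b a <;> simp [h, Set.ite]
      rw [this]
      exact hm.ite (MeasurableSet.const _) (h₁ u)
    · have : (fun a => f (if f (s a) a ≤ f b a then b else s a) a)
          = fun a => if f (s a) a ≤ f b a then f b a else f (s a) a := by
        ext a; split_ifs <;> rfl
      rw [this]
      exact Measurable.ite hm (hf b) h₂
    · dsimp only
      split_ifs with h
      · refine ⟨by simp, fun v hv => ?_⟩
        rcases Finset.mem_cons.1 hv with rfl | hv
        · exact le_rfl
        · exact ((h₃ a).2 v hv).trans h
      · refine ⟨by simp [(h₃ a).1], fun v hv => ?_⟩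
        rcases Finset.mem_cons.1 hv with rfl | hv
        · exact (not_le.1 h).le
        · exact (h₃ a).2 v hv

/-- By Fubini: for each value of `Y`, the event confines `Z` to one point. -/
theorem measure_sub_eq_const_eq_zero [IsProbabilityMeasure P] {Y Z : Ω → ℝ}
    (hY : Measurable Y) (hZ : Measurable Z) (hYZ : IndepFun Y Z P)
    [NullSingletonClass (P.map Z)] (c : ℝ) :
    P {ω | Y ω - Z ω = c} = 0 := by
  have hm : MeasurableSet {x : ℝ × ℝ | x.1 - x.2 = c} :=
    measurableSet_eq_fun (measurable_fst.sub measurable_snd) measurable_const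
  have := Measure.isProbabilityMeasure_map (μ := P) hZ.aemeasurable
  have h : P.map (fun ω => (Y ω, Z ω)) {x : ℝ × ℝ | x.1 - x.2 = c} = 0 := by
    rw [(indepFun_iff_map_prod_eq_prod_map_map hY.aemeasurable hZ.aemeasurable).1 hYZ,
      Measure.measure_prod_null hm]
    refine Filter.Eventually.of_forall fun x => ?_
    have : Prod.mk x ⁻¹' {x : ℝ × ℝ | x.1 - x.2 = c} = {x - c} := by
      ext y
      simp only [Set.mem_preimage, Set.mem_ofPred_eq, Set.mem_singleton_iff]
      constructor <;> intro h <;> linarith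
    change P.map Z _ = 0
    rw [this]
    exact measure_singleton _
  rwa [Measure.map_apply (hY.prodMk hZ) hm] at h

/-- A growing penalty off `T` eventually removes those tokens from the maximum. This links the dual
over `T`, where a minimizer exists, to the dual over all of `S`, where the infimum may be reached
only as `l → ∞` off `T`. -/
theorem tendsto_expectedMax_univ [Fintype S] [IsProbabilityMeasure P] {X : Ω → S → ℝ}
    (hX : ∀ u, Integrable (fun ω => X ω u) P) (T : Finset S) (hT : T.Nonempty)
    (hS : (Finset.univ : Finset S).Nonempty) (l : S → ℝ) :
    Filter.Tendsto (fun n : ℕ => expectedMax P X Finset.univ hS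
      (l + (Tᶜ : Set S).indicator fun _ => (n : ℝ))) Filter.atTop
      (nhds (expectedMax P X T hT l)) := by
  classical
  have hin : ∀ (n : ℕ) u, u ∈ T → (l + (Tᶜ : Set S).indicator fun _ => (n : ℝ)) u = l u :=
    fun n u hu => by simp [hu]
  have hout : ∀ (n : ℕ) u, u ∉ T → (l + (Tᶜ : Set S).indicator fun _ => (n : ℝ)) u = l u + n :=
    fun n u hu => by simp [hu]
  have hlow : ∀ (n : ℕ) ω, T.sup' hT (fun u => X ω u - l u) ≤ Finset.univ.sup' hS
      (fun u => X ω u - (l + (Tᶜ : Set S).indicator fun _ => (n : ℝ)) u) := fun n ω =>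
    Finset.sup'_le hT _ fun u hu => by
      have := Finset.le_sup' (fun u => X ω u - (l + (Tᶜ : Set S).indicator fun _ => (n : ℝ)) u)
        (Finset.mem_univ u)
      simpa only [hin n u hu] using this
  have hup : ∀ (n : ℕ) ω, Finset.univ.sup' hS
      (fun u => X ω u - (l + (Tᶜ : Set S).indicator fun _ => (n : ℝ)) u) ≤
      Finset.univ.sup' hS (fun u => X ω u - l u) := fun n ω =>
    Finset.sup'_mono_fun fun u _ => by
      by_cases hu : u ∈ T
      · rw [hin n u hu]
      · rw [hout n u hu]
        have : (0 : ℝ) ≤ n := Nat.cast_nonneg n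
        linarith
  refine tendsto_integral_of_dominated_convergence
    (fun ω => |T.sup' hT (fun u => X ω u - l u)| + |Finset.univ.sup' hS (fun u => X ω u - l u)|)
    (fun n => (integrable_sup' hX _ hS _).aestronglyMeasurable)
    ((integrable_sup' hX T hT l).abs.add (integrable_sup' hX _ hS l).abs)
    (fun n => Filter.Eventually.of_forall fun ω => ?_)
    (Filter.Eventually.of_forall fun ω => ?_)
  · rw [Real.norm_eq_abs, abs_le]
    have h₁ := hlow n ω
    have h₂ := hup n ω
    have h₃ := neg_abs_le (T.sup' hT (fun u => X ω u - l u))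
    have h₄ := le_abs_self (Finset.univ.sup' hS (fun u => X ω u - l u))
    have h₅ := abs_nonneg (T.sup' hT (fun u => X ω u - l u))
    have h₆ := abs_nonneg (Finset.univ.sup' hS (fun u => X ω u - l u))
    constructor <;> linarith
  -- Once `n ≥ N`, every penalized term lies below the maximum over `T`.
  · obtain ⟨N, hN⟩ := exists_nat_ge
      (Finset.univ.sup' hS (fun u => X ω u - l u) - T.sup' hT (fun u => X ω u - l u))
    refine tendsto_const_nhds.congr' ?_
    filter_upwards [Filter.eventually_ge_atTop N] with n hn
    refine le_antisymm (hlow n ω) (Finset.sup'_le hS _ fun u _ => ?_)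
    by_cases hu : u ∈ T
    · rw [hin n u hu]
      exact Finset.le_sup' (fun u => X ω u - l u) hu
    · rw [hout n u hu]
      have h₁ := Finset.le_sup' (fun u => X ω u - l u) (Finset.mem_univ u)
      have h₂ : (N : ℝ) ≤ n := Nat.cast_le.2 hn
      linarith

end Potential

/-! ### Duality for mechanisms -/

namespace Mechanism

variable {S : Type*} [Fintype S] {𝔾 : Set (S → ℝ)} {Ω : Type*} [MeasurableSpace Ω]
  {P : Measure Ω} [IsProbabilityMeasure P] {G : Ω → 𝔾}

open Classical in
/-- The deterministic mechanism that outputs the token `s g`. -/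
noncomputable def ofSelection (s : 𝔾 → S) (hs : ∀ u, MeasurableSet (s ⁻¹' {u})) :
    Mechanism 𝔾 where
  toFun g := ⟨Pi.single (s g) 1, single_mem_stdSimplex ℝ (s g)⟩
  measurable_toFun := by
    refine Measurable.subtype_mk (measurable_pi_lambda _ fun u => ?_)
    have : (fun g => (Pi.single (s g) 1 : S → ℝ) u) = (s ⁻¹' {u}).indicator fun _ => 1 := by
      ext g
      simp [Pi.single_apply, Set.indicator_apply, eq_comm]
    rw [this]
    exact measurable_const.indicator (hs u)

open Classical in
theorem ofSelection_prob (s : 𝔾 → S) (hs : ∀ u, MeasurableSet (s ⁻¹' {u})) (g : 𝔾) :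
    (ofSelection s hs).prob g = Pi.single (s g) 1 := rfl

theorem isDeterministic_ofSelection (s : 𝔾 → S) (hs : ∀ u, MeasurableSet (s ⁻¹' {u})) :
    (ofSelection s hs).IsDeterministic := fun g =>
  ⟨s g, by simp [ofSelection_prob], fun v hv => by simp [ofSelection_prob, hv]⟩

theorem mean_ofSelection (hG : Measurable G) (s : 𝔾 → S) (hs : ∀ u, MeasurableSet (s ⁻¹' {u}))
    (u : S) : ((ofSelection s hs).mean P hG : S → ℝ) u = P.real {ω | s (G ω) = u} := by
  have : (fun ω => (ofSelection s hs).prob (G ω) u)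
      = (G ⁻¹' (s ⁻¹' {u})).indicator fun _ => (1 : ℝ) := by
    ext ω
    by_cases h : s (G ω) = u
    · simp [ofSelection_prob, h]
    · simp [ofSelection_prob, h, Ne.symm h]
  change ∫ ω, (ofSelection s hs).prob (G ω) u ∂P = _
  rw [this, integral_indicator_const _ (hG (hs u)), smul_eq_mul, mul_one]
  rfl

theorem measurable_score {S : Type*} {𝔾 : Set (S → ℝ)} {G : Ω → 𝔾} (hG : Measurable G) (u : S) :
    Measurable fun ω => (G ω : S → ℝ) u :=
  (measurable_pi_apply u).comp (measurable_subtype_coe.comp hG)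

theorem integrable_score_mul_prob {P : Measure Ω} (hG : Measurable G)
    (hX : ∀ u, Integrable (fun ω => (G ω : S → ℝ) u) P) (q : Mechanism 𝔾) (u : S) :
    Integrable (fun ω => (G ω : S → ℝ) u * q.prob (G ω) u) P := by
  refine (hX u).mul_bdd (c := 1) ((q.measurable_prob u).comp hG).aestronglyMeasurable
    (Filter.Eventually.of_forall fun ω => ?_)
  rw [Real.norm_eq_abs, abs_of_nonneg (q.prob_nonneg _ _)]
  exact q.prob_le_one _ _

theorem objective_eq_integral_sub_add (hG : Measurable G)
    (hX : ∀ u, Integrable (fun ω => (G ω : S → ℝ) u) P) (q : Mechanism 𝔾) (l : S → ℝ) :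
    Integrable (fun ω => ∑ u, ((G ω : S → ℝ) u - l u) * q.prob (G ω) u) P ∧
    q.objective P G = (∫ ω, ∑ u, ((G ω : S → ℝ) u - l u) * q.prob (G ω) u ∂P)
      + ∑ u, l u * (q.mean P hG : S → ℝ) u := by
  have h₁ : Integrable (fun ω => ∑ u, (G ω : S → ℝ) u * q.prob (G ω) u) P :=
    integrable_finsetSum _ fun u _ => integrable_score_mul_prob hG hX q u
  have h₂ : ∀ u, Integrable (fun ω => l u * q.prob (G ω) u) P :=
    fun u => (q.integrable_prob P hG u).const_mul _
  have h₃ := integrable_finsetSum Finset.univ fun u _ => h₂ u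
  have h₄ : ∫ ω, ∑ u, l u * q.prob (G ω) u ∂P = ∑ u, l u * (q.mean P hG : S → ℝ) u := by
    rw [integral_finsetSum _ fun u _ => h₂ u]
    exact Finset.sum_congr rfl fun u _ => integral_const_mul _ _
  simp only [sub_mul, Finset.sum_sub_distrib]
  refine ⟨h₁.sub h₃, ?_⟩
  rw [integral_sub h₁ h₃, h₄, sub_add_cancel]
  rfl

/-- Weak duality: an average with weights `q(g)` is at most the maximum. -/
theorem objective_le_dualObjective (hG : Measurable G)
    (hX : ∀ u, Integrable (fun ω => (G ω : S → ℝ) u) P) (q : Mechanism 𝔾)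
    (hS : (Finset.univ : Finset S).Nonempty) (l : S → ℝ) :
    q.objective P G ≤ dualObjective P (fun ω => (G ω : S → ℝ)) Finset.univ hS
      (q.mean P hG : S → ℝ) l := by
  obtain ⟨hi, he⟩ := objective_eq_integral_sub_add hG hX q l
  rw [he]
  refine add_le_add (integral_mono hi (integrable_sup' hX _ hS l) fun ω => ?_) le_rfl
  calc ∑ u, ((G ω : S → ℝ) u - l u) * q.prob (G ω) u
      ≤ ∑ u, Finset.univ.sup' hS (fun u => (G ω : S → ℝ) u - l u) * q.prob (G ω) u :=
        Finset.sum_le_sum fun u _ => mul_le_mul_of_nonneg_right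
          (Finset.le_sup' (fun u => (G ω : S → ℝ) u - l u) (Finset.mem_univ u))
          (q.prob_nonneg _ _)
    _ = _ := by rw [← Finset.mul_sum, q.sum_prob, mul_one]

/-- Strong duality: each average distribution is attained by a deterministic mechanism whose
objective equals the infimum of the dual objective. -/
theorem exists_isDeterministic_mean_eq (hG : Measurable G)
    (hX : ∀ u, Integrable (fun ω => (G ω : S → ℝ) u) P)
    (hties : ∀ u v, u ≠ v → ∀ c, P {ω | (G ω : S → ℝ) u - (G ω : S → ℝ) v = c} = 0)
    (hS : (Finset.univ : Finset S).Nonempty) (r : stdSimplex ℝ S) :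
    ∃ q : Mechanism 𝔾, q.IsDeterministic ∧ q.mean P hG = r ∧
      ∀ c, q.objective P G < c → ∃ l,
        dualObjective P (fun ω => (G ω : S → ℝ)) Finset.univ hS (r : S → ℝ) l < c := by
  classical
  set T : Finset S := Finset.univ.filter fun u => 0 < (r : S → ℝ) u with hTdef
  have hrT : ∀ u, u ∉ T → (r : S → ℝ) u = 0 := fun u hu => by
    simp only [hTdef, Finset.mem_filter, Finset.mem_univ, true_and, not_lt] at hu
    exact le_antisymm hu (r.2.1 u)
  have hpos : ∀ u ∈ T, 0 < (r : S → ℝ) u := fun u hu => (Finset.mem_filter.1 hu).2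
  have hT : T.Nonempty := by
    by_contra h
    rw [Finset.not_nonempty_iff_eq_empty] at h
    have h₁ : ∑ u, (r : S → ℝ) u = 0 := Finset.sum_eq_zero fun u _ => hrT u (by simp [h])
    exact one_ne_zero (r.2.2.symm.trans h₁)
  obtain ⟨l, hl⟩ := exists_forall_dualObjective_le hX T hT r.2.2 hpos hrT
  obtain ⟨s, hs, hsmax⟩ := exists_measurable_argmax
    (f := fun (u : S) (g : 𝔾) => (g : S → ℝ) u - l u)
    (fun u => ((measurable_pi_apply u).comp measurable_subtype_coe).sub_const _) hT
  -- An upper bound suffices, since both vectors sum to one.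
  have hle : ∀ u, ((ofSelection s hs).mean P hG : S → ℝ) u ≤ (r : S → ℝ) u := fun u => by
    rw [mean_ofSelection]
    by_cases hu : u ∈ T
    · refine le_trans ?_ (measureReal_strict_le_of_minimizer (measurable_score hG) hX T hT hl hu)
      refine ENNReal.toReal_mono (measure_ne_top _ _) (measure_mono_ae ?_)
      have hae : ∀ᵐ ω ∂P, ∀ v, v ≠ u → (G ω : S → ℝ) v - (G ω : S → ℝ) u ≠ l v - l u := by
        rw [ae_all_iff]
        intro v
        by_cases hvu : v = u
        · simp [hvu]
        have : ∀ᵐ ω ∂P, (G ω : S → ℝ) v - (G ω : S → ℝ) u ≠ l v - l u := by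
          rw [ae_iff]
          simpa using hties v u hvu (l v - l u)
        filter_upwards [this] with ω hω _ using hω
      filter_upwards [hae] with ω hω hsu v hv hvu
      have h₁ := (hsmax (G ω)).2 v hv
      rw [show s (G ω) = u from hsu] at h₁
      refine lt_of_le_of_ne h₁ fun h => hω v hvu (by linarith)
    · have : {ω | s (G ω) = u} = ∅ := by
        ext ω
        simp only [Set.mem_ofPred_eq, Set.mem_empty_iff_false, iff_false]
        rintro rfl
        exact hu (hsmax (G ω)).1
      rw [this, measureReal_empty]
      exact r.2.1 u
  have hmean : (ofSelection s hs).mean P hG = r := by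
    have h := (Finset.sum_eq_sum_iff_of_le fun u (_ : u ∈ Finset.univ) => hle u).1
      (((ofSelection s hs).mean P hG).2.2.trans r.2.2.symm)
    exact Subtype.ext (funext fun u => h u (Finset.mem_univ u))
  have hobj : (ofSelection s hs).objective P G
      = dualObjective P (fun ω => (G ω : S → ℝ)) T hT (r : S → ℝ) l := by
    rw [(objective_eq_integral_sub_add hG hX (ofSelection s hs) l).2, hmean]
    unfold dualObjective expectedMax
    congr 1
    refine integral_congr_ae (Filter.Eventually.of_forall fun ω => ?_)
    have h₁ := hsmax (G ω)
    simp only [ofSelection_prob, Pi.single_apply, mul_ite, mul_one, mul_zero, Finset.sum_ite_eq',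
      Finset.mem_univ, if_true]
    exact le_antisymm (Finset.le_sup' (fun u => (G ω : S → ℝ) u - l u) h₁.1)
      (Finset.sup'_le hT _ h₁.2)
  refine ⟨ofSelection s hs, isDeterministic_ofSelection s hs, hmean, fun c hc => ?_⟩
  -- The penalty is free in the linear term because `r` vanishes off `T`.
  have hsum : ∀ n : ℕ, ∑ u, (l + (Tᶜ : Set S).indicator fun _ => (n : ℝ)) u * (r : S → ℝ) u
      = ∑ u, l u * (r : S → ℝ) u := fun n => Finset.sum_congr rfl fun u _ => by
    by_cases hu : u ∈ T
    · simp [hu]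
    · simp [hrT u hu]
  have hlim := (tendsto_expectedMax_univ hX T hT hS l).add_const (∑ u, l u * (r : S → ℝ) u)
  rw [hobj] at hc
  obtain ⟨n, hn⟩ := (hlim.eventually_lt_const hc).exists
  refine ⟨l + (Tᶜ : Set S).indicator fun _ => (n : ℝ), ?_⟩
  unfold dualObjective
  rw [hsum n]
  exact hn

end Mechanism

end Watermark

/-! ### Existence of deterministic optima -/

theorem mainTheorem1 {S : Type*} [Fintype S] (𝔾 : Set (S → ℝ))
    {Ω : Type*} [MeasurableSpace Ω] (P : Measure Ω) [IsProbabilityMeasure P]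
    (G : Ω → 𝔾) (hG : Measurable G)
    (L : Measure ℝ) [NullSingletonClass L] (hL : Integrable (fun x : ℝ => x) L)
    (hindep : iIndepFun (fun (u : S) (ω : Ω) => (G ω : S → ℝ) u) P)
    (hlaw : ∀ u : S, P.map (fun ω => (G ω : S → ℝ) u) = L)
    (p : stdSimplex ℝ S) (ε : ℝ) (hε : 0 ≤ ε)
    (D : stdSimplex ℝ S → stdSimplex ℝ S → ℝ) :
    ((∃ q : Watermark.Mechanism 𝔾, q.IsOptimal P hG D p ε) →
      ∃ q : Watermark.Mechanism 𝔾, q.IsOptimal P hG D p ε ∧ q.IsDeterministic) ∧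
    (IsClosed {r : stdSimplex ℝ S | D r p ≤ ε} →
      (∃ q : Watermark.Mechanism 𝔾, q.IsFeasible P hG D p ε) →
      ∃ q : Watermark.Mechanism 𝔾, q.IsOptimal P hG D p ε ∧ q.IsDeterministic) := by
  have hS : (Finset.univ : Finset S).Nonempty := by
    by_contra h
    rw [Finset.not_nonempty_iff_eq_empty] at h
    have h₁ := p.2.2
    rw [h, Finset.sum_empty] at h₁
    exact zero_ne_one h₁
  have hm := Watermark.Mechanism.measurable_score hG
  have hX : ∀ u, Integrable (fun ω => (G ω : S → ℝ) u) P := fun u => by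
    rw [← hlaw u] at hL
    exact hL.comp_measurable (hm u)
  have hties : ∀ u v, u ≠ v → ∀ c, P {ω | (G ω : S → ℝ) u - (G ω : S → ℝ) v = c} = 0 := by
    intro u v huv c
    have : NullSingletonClass (P.map fun ω => (G ω : S → ℝ) v) := by rw [hlaw v]; infer_instance
    exact Watermark.measure_sub_eq_const_eq_zero (hm u) (hm v) (hindep.indepFun huv) c
  choose Q hdet hmean hdual using
    Watermark.Mechanism.exists_isDeterministic_mean_eq hG hX hties hS
  have hbest : ∀ q : Watermark.Mechanism 𝔾,
      q.objective P G ≤ (Q (q.mean P hG)).objective P G := fun q => by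
    by_contra! h
    obtain ⟨l, hl⟩ := hdual _ _ h
    exact (q.objective_le_dualObjective hG hX hS l).not_gt hl
  refine ⟨fun ⟨q, hq, hopt⟩ => ⟨Q (q.mean P hG), ⟨?_, fun q' hq' => ?_⟩, hdet _⟩,
    fun hclosed ⟨q₀, hq₀⟩ => ?_⟩
  · unfold Watermark.Mechanism.IsFeasible
    rw [hmean]
    exact hq
  · exact (hopt q' hq').trans (hbest q)
  -- A dual `l` that is below `c` at `r` stays below `c` nearby, and by weak duality bounds the
  -- value there.
  · have husc : UpperSemicontinuous fun r => (Q r).objective P G := by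
      intro r c hc
      obtain ⟨l, hl⟩ := hdual r c hc
      have hcont : Continuous fun r' : stdSimplex ℝ S => Watermark.dualObjective P
          (fun ω => (G ω : S → ℝ)) Finset.univ hS (r' : S → ℝ) l :=
        continuous_const.add (continuous_finsetSum _ fun u _ =>
          continuous_const.mul ((continuous_apply u).comp continuous_subtype_val))
      filter_upwards [hcont.continuousAt.eventually_lt_const hl] with r' hr'
      have := (Q r').objective_le_dualObjective hG hX hS l
      rw [hmean r'] at this
      exact this.trans_lt hr'
    obtain ⟨r, hr, hmax⟩ := (husc.upperSemicontinuousOn _).exists_isMaxOn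
      (s := {r : stdSimplex ℝ S | D r p ≤ ε}) ⟨q₀.mean P hG, hq₀⟩ hclosed.isCompact
    refine ⟨Q r, ⟨?_, fun q' hq' => (hbest q').trans (hmax hq')⟩, hdet r⟩
    unfold Watermark.Mechanism.IsFeasible
    rw [hmean]
    exact hr
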